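/- Let $\Gamma$ be a countable discrete group acting on a countable set $X$, and for $g\in\Gamma$ let $u_g$ be the permutation unitary $(u_g\xi)(x)=\xi(g^{-1}x)$ on $\ell^2(X)$. Let $C^*\Gamma\to\mathbb B(\ell^2X)/\mathbb K(\ell^2X)$ be the associated Calkin representation, i.e. the $*$-homomorphism sending each $g\in\Gamma$ to the class $[u_g]$ modulo the compact operators. Suppose that it is tempered, i.e. that it factors through the canonical surjection $C^*\Gamma\to C^*_\lambda\Gamma$; equivalently, there is a unital $*$-homomorphism $\Phi:C^*_\lambda\Gamma\to\mathbb B(\ell^2X)/\mathbb K(\ell^2X)$ with $\Phi(\lambda_g)=[u_g]$ for all $g\in\Gamma$, where $C^*_\lambda\Gamma\subset\mathbb B(\ell^2\Gamma)$ is the reduced group $C^*$-algebra generated by the left regular representation $\lambda$. Let $\Lambda$ be a subgroup of $\Gamma$ that fixes a Borel probability measure on the Stone–Čech boundary $\partial_\beta X=\beta X\setminus X$ of the discrete set $X$. Then $\Lambda$ is amenable. -/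

import Mathlib

open scoped ENNReal lp

/-- The Hilbert space `ℓ²(X)` of square-summable complex functions on a set `X`. -/
abbrev EllTwo (X : Type*) : Type _ := lp (fun _ : X => ℂ) 2

/-- The algebra `𝔹(ℓ²(X))` of bounded operators. -/
abbrev BoundedOps (X : Type*) : Type _ := EllTwo X →L[ℂ] EllTwo X

section Permutation

variable {Γ X : Type*} [Group Γ] [MulAction Γ X]

theorem memlp_smul (g : Γ) (ξ : EllTwo X) :
    Memℓp (fun x : X => ξ (g⁻¹ • x)) 2 := by
  have h : Summable fun x : X => ‖ξ x‖ ^ (2 : ℝ≥0∞).toReal := (lp.memℓp ξ).summable (by norm_num)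
  exact memℓp_gen (h.comp_injective (MulAction.injective g⁻¹))

/-- The isometry `ξ ↦ ξ(g⁻¹ ·)` of `ℓ²(X)`. -/
noncomputable def permIsometry (g : Γ) : EllTwo X →ₗᵢ[ℂ] EllTwo X where
  toFun ξ := ⟨fun x => ξ (g⁻¹ • x), memlp_smul g ξ⟩
  map_add' _ _ := rfl
  map_smul' _ _ := rfl
  norm_map' ξ := by
    have h2 : 0 < (2 : ℝ≥0∞).toReal := by norm_num
    rw [lp.norm_eq_tsum_rpow h2, lp.norm_eq_tsum_rpow h2]
    congr 1
    exact (MulAction.toPerm g⁻¹).tsum_eq fun x : X => ‖ξ x‖ ^ (2 : ℝ≥0∞).toReal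

variable (Γ X) in
/-- The permutation representation of `Γ` on `ℓ²(X)`: `(u_g ξ)(x) = ξ(g⁻¹ x)`. For `X = Γ` with
left multiplication this is the left regular representation. -/
noncomputable def permRep : Γ →* BoundedOps X where
  toFun g := (permIsometry g).toContinuousLinearMap
  map_one' := by
    ext ξ x
    change ξ ((1 : Γ)⁻¹ • x) = ξ x
    simp
  map_mul' g h := by
    ext ξ x
    change ξ ((g * h)⁻¹ • x) = ξ (h⁻¹ • g⁻¹ • x)
    rw [mul_inv_rev, mul_smul]

@[simp]
theorem permRep_apply (g : Γ) (ξ : EllTwo X) (x : X) : permRep Γ X g ξ x = ξ (g⁻¹ • x) := rfl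

end Permutation

section Calkin

variable (H : Type*) [NormedAddCommGroup H] [InnerProductSpace ℂ H] [CompleteSpace H]

/-- The ideal `𝕂(H)` of compact operators in `𝔹(H)`. -/
def compactIdeal : Ideal (H →L[ℂ] H) where
  carrier := {T | IsCompactOperator T}
  add_mem' hS hT := hS.add hT
  zero_mem' := isCompactOperator_zero
  smul_mem' S _ hT := hT.clm_comp S

instance compactIdeal_isTwoSided : (compactIdeal H).IsTwoSided :=
  ⟨fun {_} S hT => IsCompactOperator.comp_clm hT S⟩

variable {H} in
theorem star_mem_compactIdeal {T : H →L[ℂ] H} (hT : T ∈ compactIdeal H) :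
    star T ∈ compactIdeal H := by
  have hS : IsCompactOperator (T * star T) := IsCompactOperator.comp_clm hT (star T)
  have hS' := (hS.isCompact_closure_image_closedBall (1 : ℝ)).totallyBounded.subset subset_closure
  refine (isCompactOperator_iff_isCompact_closure_image_closedBall
    ((star T : H →L[ℂ] H) : H →ₗ[ℂ] H) one_pos).2 ?_
  refine TotallyBounded.isCompact_of_isClosed (TotallyBounded.closure ?_) isClosed_closure
  rw [Metric.totallyBounded_iff]
  intro ε hε
  obtain ⟨t, htS, htf, ht⟩ := Metric.finite_approx_of_totallyBounded hS' (ε ^ 2 / 2) (by positivity)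
  obtain ⟨t', ht', htf', rfl⟩ := Set.exists_subset_image_finite_and.1 ⟨t, htS, htf, rfl⟩
  refine ⟨(fun x => (star T : H →L[ℂ] H) x) '' t', htf'.image _, ?_⟩
  rintro _ ⟨x, hx, rfl⟩
  have h1 := ht (Set.mem_image_of_mem _ hx)
  simp only [Set.mem_iUnion, Metric.mem_ball, Set.mem_image, exists_prop,
    exists_exists_and_eq_and] at h1 ⊢
  obtain ⟨y, hy, hxy⟩ := h1
  refine ⟨y, hy, ?_⟩
  have hx1 : ‖x‖ ≤ 1 := by simpa using hx
  have hy1 : ‖y‖ ≤ 1 := by simpa using ht' hy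
  rw [dist_eq_norm, ← map_sub] at hxy
  change ‖(T * star T) (x - y)‖ < ε ^ 2 / 2 at hxy
  change dist (star T x) (star T y) < ε
  rw [dist_eq_norm, ← map_sub]
  have hd : ‖x - y‖ ≤ 2 := (norm_sub_le _ _).trans (by linarith)
  have key : ‖star T (x - y)‖ ^ 2 ≤ ‖(T * star T) (x - y)‖ * ‖x - y‖ := by
    have h3 : inner ℂ ((T * star T) (x - y)) (x - y) = inner ℂ (star T (x - y)) (star T (x - y)) := by
      rw [ContinuousLinearMap.star_eq_adjoint, ContinuousLinearMap.adjoint_inner_right]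
      rfl
    rw [← inner_self_eq_norm_sq (𝕜 := ℂ), ← h3]
    exact re_inner_le_norm _ _
  have : ‖star T (x - y)‖ ^ 2 < ε ^ 2 := by
    have := mul_le_mul_of_nonneg_left hd (norm_nonneg ((T * star T) (x - y)))
    linarith
  exact lt_of_pow_lt_pow_left₀ 2 hε.le this

/-- The Calkin algebra `𝔹(H) / 𝕂(H)`. -/
abbrev CalkinAlgebra : Type _ := (H →L[ℂ] H) ⧸ compactIdeal H

/-- The involution `[T]* = [T*]` of the Calkin algebra. -/
noncomputable instance CalkinAlgebra.instStarRing : StarRing (CalkinAlgebra H) where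
  star := Quotient.map' star (fun S T h => by
    rw [Submodule.quotientRel_def] at h ⊢
    rw [← star_sub]
    exact star_mem_compactIdeal h)
  star_involutive a := by
    induction a using Submodule.Quotient.induction_on with | _ S =>
    exact congrArg (Ideal.Quotient.mk _) (star_star S)
  star_mul a b := by
    induction a using Submodule.Quotient.induction_on with | _ S =>
    induction b using Submodule.Quotient.induction_on with | _ T =>
    exact congrArg (Ideal.Quotient.mk _) (star_mul S T)
  star_add a b := by
    induction a using Submodule.Quotient.induction_on with | _ S =>
    induction b using Submodule.Quotient.induction_on with | _ T =>
    exact congrArg (Ideal.Quotient.mk _) (star_add S T)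

theorem CalkinAlgebra.star_mk (T : H →L[ℂ] H) :
    star (Ideal.Quotient.mk (compactIdeal H) T) = Ideal.Quotient.mk (compactIdeal H) (star T) := rfl

end Calkin

/-- The Calkin representation of `Γ` associated with an action of `Γ` on `X`: the class of the
permutation unitary `u_g` in the Calkin algebra of `ℓ²(X)`. -/
noncomputable def calkinRep (Γ X : Type*) [Group Γ] [MulAction Γ X] :
    Γ →* CalkinAlgebra (EllTwo X) :=
  (Ideal.Quotient.mk (compactIdeal (EllTwo X)) : BoundedOps X →* CalkinAlgebra (EllTwo X)).comp
    (permRep Γ X)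

/-- The reduced group C*-algebra `C*_λ(Γ)`: the norm-closed *-subalgebra of `𝔹(ℓ²(Γ))` generated by
the left regular representation. -/
noncomputable def reducedGroupCStar (Γ : Type*) [Group Γ] : StarSubalgebra ℂ (BoundedOps Γ) :=
  (StarAlgebra.adjoin ℂ (Set.range (permRep Γ Γ))).topologicalClosure

theorem permRep_mem_reducedGroupCStar {Γ : Type*} [Group Γ] (g : Γ) :
    permRep Γ Γ g ∈ reducedGroupCStar Γ :=
  StarSubalgebra.le_topologicalClosure _ (StarAlgebra.subset_adjoin ℂ _ ⟨g, rfl⟩)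

/-- A representation `π` of `Γ` in a unital *-algebra `A` is tempered if it factors through the
reduced group C*-algebra: there is a unital *-homomorphism `Φ : C*_λ(Γ) → A` with `Φ(λ_g) = π(g)`
for all `g`. -/
def IsTempered {Γ : Type*} [Group Γ] {A : Type*} [Ring A] [Algebra ℂ A] [StarRing A]
    (π : Γ →* A) : Prop :=
  ∃ Φ : reducedGroupCStar Γ →⋆ₐ[ℂ] A,
    ∀ g : Γ, Φ ⟨permRep Γ Γ g, permRep_mem_reducedGroupCStar g⟩ = π g

section Boundary

/-- The Stone–Čech boundary `∂_β X = βX ∖ X` of the discrete set `X`: `βX` is the space of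
ultrafilters on `X`, in which `X` sits as the set of principal ultrafilters. -/
def StoneCechBoundary (X : Type*) : Type _ := {p : Ultrafilter X // ∀ x : X, p ≠ pure x}

namespace StoneCechBoundary

variable {Γ X : Type*} [Group Γ] [MulAction Γ X]

instance : TopologicalSpace (StoneCechBoundary X) :=
  inferInstanceAs (TopologicalSpace {p : Ultrafilter X // ∀ x : X, p ≠ pure x})

instance : MeasurableSpace (StoneCechBoundary X) := borel _

instance : BorelSpace (StoneCechBoundary X) := ⟨rfl⟩

/-- The action of `Γ` on `∂_β X`, the continuous extension of the action on `X`. -/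
instance : MulAction Γ (StoneCechBoundary X) where
  smul g p := ⟨p.1.map (g • ·), fun x hx => p.2 (g⁻¹ • x) (by
    have := congrArg (Ultrafilter.map (g⁻¹ • · : X → X)) hx
    rw [Ultrafilter.map_map] at this
    simpa [Function.comp_def, Ultrafilter.map_pure] using this)⟩
  one_smul p := Subtype.ext (by
    change p.1.map ((1 : Γ) • · : X → X) = p.1
    simp)
  mul_smul g h p := Subtype.ext (by
    change p.1.map ((g * h) • · : X → X) = (p.1.map (h • ·)).map (g • ·)
    rw [Ultrafilter.map_map]
    simp only [mul_smul, Function.comp_def])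

instance : ContinuousConstSMul Γ (StoneCechBoundary X) where
  continuous_const_smul g := by
    refine Continuous.subtype_mk (f := fun p : StoneCechBoundary X => p.1.map (g • · : X → X)) ?_ _
    refine Continuous.comp (g := fun p : Ultrafilter X => p.map (g • · : X → X)) ?_
      continuous_subtype_val
    refine ultrafilterBasis_is_basis.continuous_iff.2 ?_
    rintro _ ⟨s, rfl⟩
    exact ultrafilter_isOpen_basic ((g • · : X → X) ⁻¹' s)

end StoneCechBoundary

end Boundary

/-- A (discrete) group is amenable if it carries a left-invariant finitely additive probability
measure defined on all of its subsets. -/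
def IsAmenable (G : Type*) [Group G] : Prop :=
  ∃ m : Set G → ℝ, (∀ A, 0 ≤ m A) ∧ m Set.univ = 1 ∧
    (∀ A B, Disjoint A B → m (A ∪ B) = m A + m B) ∧
    ∀ (g : G) (A : Set G), m ((g * ·) '' A) = m A

/-!
Integration against an invariant probability measure on `∂_β X` is a `Λ`-invariant mean on `X`
that ignores finite sets. By Hahn–Banach separation (`exists_almost_invariant_prob`) it yields,
for any finite subset of `Λ`, almost invariant probability vectors on `X` off any given finite
set; their square roots are almost invariant unit vectors in `ℓ²(X)` that tend weakly to zero.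

Compact operators do not see such vectors, so for finite `F ⊆ Λ` the number `|F|` lies in the
spectrum of `∑ g ∈ F, [u_g]` in the Calkin algebra. As a unital homomorphism preserves
invertibility, temperedness puts `|F|` in the spectrum of `∑ g ∈ F, λ_g` in `C*_λ(Γ)`, so that
this operator has norm at least `|F|` (`card_le_norm_sum_regular`). This is Kesten's criterion: by
the parallelogram law `ℓ²(Γ)` has almost `Λ`-invariant unit vectors `η`, and the probability
vectors `|η|²`, pushed forward along a `Λ`-equivariant map `Γ → Λ`, accumulate at an invariant
mean on `Λ` (`isAmenable_of_almost_invariant`).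

Only the invertibility of elements is transported along the homomorphism, so no norm on the Calkin
algebra is needed.
-/

open Filter Topology MeasureTheory

/-! ### Almost invariant vectors from an invariant measure on the boundary -/

/-- A bounded function on `X` extends continuously to `∂_β X`: its value at an ultrafilter `p` is
its limit along `p`. -/
theorem exists_boundary_extension {X : Type*} (h : X → ℝ) {C : ℝ} (hC : ∀ x, |h x| ≤ C) :
    ∃ k : StoneCechBoundary X → ℝ, Continuous k ∧ (∀ p, |k p| ≤ C) ∧
      ∀ p, Tendsto h p.1 (𝓝 (k p)) := by
  let h' : X → Set.Icc (-C) C := fun x => ⟨h x, abs_le.1 (hC x)⟩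
  have hcont : Continuous (Ultrafilter.extend h') := continuous_ultrafilter_extend h'
  refine ⟨fun p => (Ultrafilter.extend h' p.1).1,
    continuous_subtype_val.comp (hcont.comp continuous_subtype_val),
    fun p => abs_le.2 (Ultrafilter.extend h' p.1).2, fun p => ?_⟩
  have h1 : Tendsto h' p.1 (𝓝 (Ultrafilter.extend h' p.1)) :=
    ultrafilter_extend_eq_iff.1 rfl
  exact (continuous_subtype_val.tendsto _).comp h1

theorem StoneCechBoundary.eventually_notMem {X : Type*} (p : StoneCechBoundary X) (E : Finset X) :
    ∀ᶠ x in (p.1 : Filter X), x ∉ E := by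
  refine Ultrafilter.eventually_not.2 fun hE => ?_
  obtain ⟨x, -, hx⟩ := Ultrafilter.eq_pure_of_finite_mem E.finite_toSet hE
  exact p.2 x hx

/-- If the `s i` preserve a probability measure on the boundary, then no sum of coboundaries
`h i ∘ s i - h i` of bounded functions is at least `δ > 0` off a finite set: its extension to the
boundary would be at least `δ` everywhere and have integral zero. -/
theorem exists_sum_coboundary_lt {Γ X ι : Type*} [Group Γ] [MulAction Γ X] [Fintype ι]
    (s : ι → Γ) (μ : Measure (StoneCechBoundary X)) [IsProbabilityMeasure μ]
    (hμ : ∀ i, μ.map (s i • ·) = μ) (E : Finset X) (h : ι → X → ℝ) {C : ℝ}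
    (hC : ∀ i x, |h i x| ≤ C) {δ : ℝ} (hδ : 0 < δ) :
    ∃ x ∉ E, ∑ i, (h i (s i • x) - h i x) < δ := by
  by_contra! hE
  choose k hk hkC hlim using fun i => exists_boundary_extension (h i) (hC i)
  have hint : ∀ i, Integrable (k i) μ := fun i =>
    Integrable.of_bound (hk i).aestronglyMeasurable C (Eventually.of_forall (hkC i))
  have hint' : ∀ i, Integrable (fun p => k i (s i • p)) μ := fun i =>
    Integrable.of_bound ((hk i).comp (continuous_const_smul (s i))).aestronglyMeasurable C
      (Eventually.of_forall fun p => hkC i _)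
  have hinv : ∀ i, ∫ p, k i (s i • p) ∂μ = ∫ p, k i p ∂μ := fun i => by
    conv_rhs => rw [← hμ i]
    exact (integral_map (continuous_const_smul (s i)).aemeasurable
      (hk i).aestronglyMeasurable).symm
  have hle : ∀ p, δ ≤ ∑ i, (k i (s i • p) - k i p) := fun p =>
    ge_of_tendsto (tendsto_finsetSum _ fun i _ =>
      (show Tendsto (fun x => h i (s i • x)) p.1 (𝓝 (k i (s i • p))) from
        hlim i (s i • p)).sub (hlim i p)) ((p.eventually_notMem E).mono hE)
  have h1 : ∫ _, δ ∂μ ≤ ∫ p, ∑ i, (k i (s i • p) - k i p) ∂μ :=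
    integral_mono (integrable_const _)
      (integrable_finsetSum _ fun i _ => (hint' i).sub (hint i)) hle
  rw [integral_finsetSum (f := fun i p => k i (s i • p) - k i p) _
    fun i _ => (hint' i).sub (hint i)] at h1
  simp only [integral_sub (hint' _) (hint _), hinv, sub_self, Finset.sum_const_zero,
    integral_const, probReal_univ, one_smul] at h1
  linarith

/-- Day's trick: invariance of a measure on the boundary is approximated in `ℓ¹`-norm by probability
vectors on `X`, supported off any given finite set. -/
theorem exists_almost_invariant_prob {Γ X ι : Type*} [Group Γ] [MulAction Γ X] [Fintype ι]
    (s : ι → Γ) (μ : Measure (StoneCechBoundary X)) [IsProbabilityMeasure μ]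
    (hμ : ∀ i, μ.map (s i • ·) = μ) (E : Finset X) {ε : ℝ} (hε : 0 < ε) :
    ∃ p : X → ℝ, (∀ x, 0 ≤ p x) ∧ HasSum p 1 ∧ (∀ x ∈ E, p x = 0) ∧
      ∀ i, Summable (fun x => |p ((s i)⁻¹ • x) - p x|) ∧
        ∑' x, |p ((s i)⁻¹ • x) - p x| < ε := by
  classical
  let V := ι → lp (fun _ : X => ℝ) 1
  let K : Set V := {v | ∃ p : X → ℝ, (∀ x, 0 ≤ p x) ∧ HasSum p 1 ∧ (∀ x ∈ E, p x = 0) ∧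
    ∀ i x, v i x = p ((s i)⁻¹ • x) - p x}
  have hK : Convex ℝ K := by
    rintro v ⟨p, hp, hp1, hpE, hpv⟩ w ⟨q, hq, hq1, hqE, hqw⟩ a b ha hb hab
    refine ⟨fun x => a * p x + b * q x, fun x => by have := hp x; have := hq x; positivity,
      by simpa [hab] using (hp1.mul_left a).add (hq1.mul_left b),
      fun x hx => by simp [hpE x hx, hqE x hx], fun i x => ?_⟩
    have : (a • v + b • w) i x = a * v i x + b * w i x := rfl
    rw [this, hpv, hqw]
    ring
  -- If `0` were not in the closure of the convex set `K`, a functional `f` would separate them, and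
  -- evaluating `f` at the differences of point masses would give a forbidden sum of coboundaries.
  by_cases hdisj : Disjoint (Metric.ball (0 : V) ε) K
  · exfalso
    obtain ⟨f, u, hfu, huf⟩ :=
      geometric_hahn_banach_open (convex_ball _ _) Metric.isOpen_ball hK hdisj
    have hu : 0 < u := by simpa using hfu 0 (by simpa using hε)
    let e : X → lp (fun _ : X => ℝ) 1 := fun x => lp.single 1 x 1
    obtain ⟨x, hxE, hx⟩ := exists_sum_coboundary_lt s μ hμ E
      (fun i x => f (Pi.single i (e x))) (C := ‖f‖) (fun i x => by
        refine (f.le_opNorm _).trans ?_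
        have : ‖(Pi.single i (e x) : V)‖ ≤ 1 := by
          refine (pi_norm_le_iff_of_nonneg zero_le_one).2 fun j => ?_
          rcases eq_or_ne j i with rfl | hj
          · simp [e, lp.norm_single]
          · simp [Pi.single_eq_of_ne hj]
        nlinarith [norm_nonneg f]) hu
    have hv := huf (fun i => e (s i • x) - e x) ⟨Pi.single x 1, fun y => ?_, ?_, fun y hy => ?_,
      fun i y => ?_⟩
    · have h2 : f (fun i => e (s i • x) - e x) =
          ∑ i, (f (Pi.single i (e (s i • x))) - f (Pi.single i (e x))) := by
        rw [← Finset.univ_sum_single (fun i => e (s i • x) - e x), map_sum]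
        refine Finset.sum_congr rfl fun i _ => ?_
        rw [Pi.single_sub, map_sub]
      linarith
    · by_cases h : y = x <;> simp [h]
    · exact hasSum_pi_single x 1
    · exact Pi.single_eq_of_ne (by rintro rfl; exact hxE hy) _
    · simp [e, Pi.single_apply, inv_smul_eq_iff]
  · obtain ⟨v, hv, p, hp, hp1, hpE, hpv⟩ := Set.not_disjoint_iff.1 hdisj
    refine ⟨p, hp, hp1, hpE, fun i => ?_⟩
    have hs := lp.hasSum_norm (p := 1) (by simp) (v i)
    simp only [ENNReal.toReal_one, Real.rpow_one, Real.norm_eq_abs, hpv] at hs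
    refine ⟨hs.summable, ?_⟩
    rw [hs.tsum_eq]
    exact (norm_le_pi_norm v i).trans_lt (by simpa using hv)

theorem ellTwo_hasSum_norm_sq {X : Type*} (ξ : EllTwo X) :
    HasSum (fun x => ‖ξ x‖ ^ 2) (‖ξ‖ ^ 2) := by
  simpa using lp.hasSum_norm (p := 2) (by simp) ξ

/-- The square roots of almost invariant probability vectors are almost invariant unit vectors
of `ℓ²(X)`, by `|√a - √b|² ≤ |a - b|`. -/
theorem exists_almost_invariant_vector {Γ X ι : Type*} [Group Γ] [MulAction Γ X] [Fintype ι]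
    (s : ι → Γ) (μ : Measure (StoneCechBoundary X)) [IsProbabilityMeasure μ]
    (hμ : ∀ i, μ.map (s i • ·) = μ) (E : Finset X) {ε : ℝ} (hε : 0 < ε) :
    ∃ ξ : EllTwo X, ‖ξ‖ = 1 ∧ (∀ x ∈ E, ξ x = 0) ∧
      ∀ i, ‖permRep Γ X (s i) ξ - ξ‖ < ε := by
  obtain ⟨p, hp, hp1, hpE, hpi⟩ := exists_almost_invariant_prob s μ hμ E (pow_pos hε 2)
  have hnorm : ∀ x, ‖((√(p x) : ℝ) : ℂ)‖ ^ 2 = p x := fun x => by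
    rw [Complex.norm_real, Real.norm_eq_abs, sq_abs, Real.sq_sqrt (hp x)]
  let ξ : EllTwo X := ⟨fun x => ((√(p x) : ℝ) : ℂ), memℓp_gen (by
    simpa [hnorm, Real.sq_sqrt (hp _)] using hp1.summable)⟩
  have hξ : ∀ x, ξ x = ((√(p x) : ℝ) : ℂ) := fun _ => rfl
  refine ⟨ξ, ?_, fun x hx => by simp [hξ, hpE x hx], fun i => ?_⟩
  · have h1 := ellTwo_hasSum_norm_sq ξ
    simp only [hξ, hnorm] at h1
    exact (pow_eq_one_iff_of_nonneg (norm_nonneg ξ) two_ne_zero).1 (h1.unique hp1)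
  · refine lt_of_pow_lt_pow_left₀ 2 hε.le (lt_of_le_of_lt ?_ (hpi i).2)
    refine hasSum_le (fun x => ?_) (ellTwo_hasSum_norm_sq _) (hpi i).1.hasSum
    change ‖ξ ((s i)⁻¹ • x) - ξ x‖ ^ 2 ≤ _
    rw [hξ, hξ, ← Complex.ofReal_sub, Complex.norm_real, Real.norm_eq_abs]
    generalize (s i)⁻¹ • x = y
    have ha := Real.sq_sqrt (hp y)
    have hb := Real.sq_sqrt (hp x)
    calc |√(p y) - √(p x)| ^ 2 ≤ |√(p y) - √(p x)| * (√(p y) + √(p x)) := by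
          rw [sq]
          gcongr
          exact abs_le.2 ⟨by linarith [Real.sqrt_nonneg (p y)],
            by linarith [Real.sqrt_nonneg (p x)]⟩
      _ = |(√(p y) - √(p x)) * (√(p y) + √(p x))| := by
          rw [abs_mul, abs_of_nonneg (add_nonneg (Real.sqrt_nonneg _) (Real.sqrt_nonneg _))]
      _ = |p y - p x| := by congr 1; linear_combination ha - hb

/-! ### Temperedness and norms in the regular representation -/

/-- Unit vectors of `ℓ²(X)` that leave every finite set converge weakly to zero. -/
theorem tendsto_inner_ellTwo_of_vanishing {X : Type*} {ξ : Finset X → EllTwo X}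
    (h1 : ∀ E, ‖ξ E‖ ≤ 1) (hξ : ∀ E, ∀ x ∈ E, ξ E x = 0) (z : EllTwo X) :
    Tendsto (fun E => inner ℂ z (ξ E)) atTop (𝓝 0) := by
  classical
  have hz : Tendsto (fun E : Finset X => ‖z - ∑ x ∈ E, lp.single 2 x (z x)‖) atTop (𝓝 0) := by
    have := (lp.hasSum_single (p := 2) (by simp) z).const_sub z
    simpa using this.norm
  refine squeeze_zero_norm (fun E => ?_) hz
  have h0 : inner ℂ (∑ x ∈ E, lp.single 2 x (z x)) (ξ E) = 0 := by
    rw [sum_inner]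
    refine Finset.sum_eq_zero fun x hx => ?_
    rw [lp.inner_single_left, hξ E x hx, inner_zero_right]
  calc ‖inner ℂ z (ξ E)‖ = ‖inner ℂ (z - ∑ x ∈ E, lp.single 2 x (z x)) (ξ E)‖ := by
        rw [inner_sub_left, h0, sub_zero]
    _ ≤ ‖z - ∑ x ∈ E, lp.single 2 x (z x)‖ * ‖ξ E‖ := norm_inner_le_norm _ _
    _ ≤ _ := mul_le_of_le_one_right (norm_nonneg _) (h1 E)

/-- A compact operator sends vectors of the unit ball that leave every finite set to vectors that
are not bounded away from zero. -/
theorem exists_norm_compact_lt {X : Type*} {K : BoundedOps X} (hK : K ∈ compactIdeal (EllTwo X))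
    {ξ : Finset X → EllTwo X} (h1 : ∀ E, ‖ξ E‖ ≤ 1) (hξ : ∀ E, ∀ x ∈ E, ξ E x = 0)
    {ε : ℝ} (hε : 0 < ε) : ∃ E, ‖K (ξ E)‖ < ε := by
  have hK' : IsCompactOperator K := hK
  have hcpt : IsCompact (closure (K '' Metric.closedBall 0 1)) :=
    hK'.isCompact_closure_image_closedBall (f := (K : EllTwo X →ₗ[ℂ] EllTwo X)) 1
  let U : Ultrafilter (Finset X) := Ultrafilter.of atTop
  obtain ⟨y, -, hy⟩ := hcpt.ultrafilter_le_nhds (U.map fun E => K (ξ E)) (by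
    refine le_principal_iff.2 (Ultrafilter.mem_map.2 (Eventually.of_forall fun E => ?_))
    exact subset_closure ⟨ξ E, by simpa using h1 E, rfl⟩)
  have hy' : Tendsto (fun E => K (ξ E)) U (𝓝 y) := hy
  have hy0 : inner ℂ y y = 0 := by
    refine tendsto_nhds_unique (tendsto_const_nhds.inner hy') ?_
    simp only [← ContinuousLinearMap.adjoint_inner_left]
    exact (tendsto_inner_ellTwo_of_vanishing h1 hξ _).mono_left (Ultrafilter.of_le _)
  rw [inner_self_eq_zero] at hy0
  subst hy0
  exact ((hy'.norm.eventually (gt_mem_nhds (by simpa using hε))).exists)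

theorem norm_permRep {Γ X : Type*} [Group Γ] [MulAction Γ X] (g : Γ) (ξ : EllTwo X) :
    ‖permRep Γ X g ξ‖ = ‖ξ‖ := (permIsometry g).norm_map ξ

/-- Suppose that the Calkin representation is tempered and that the `s i` have almost invariant unit
vectors in `ℓ²(X)` off every finite set. Then `∑ i, λ_{s i}` has the largest norm it could have. -/
theorem card_le_norm_sum_regular {Γ X ι : Type*} [Group Γ] [MulAction Γ X] [Fintype ι]
    (hΓ : IsTempered (calkinRep Γ X)) (s : ι → Γ)
    (hs : ∀ (E : Finset X) (ε : ℝ), 0 < ε → ∃ ξ : EllTwo X, ‖ξ‖ = 1 ∧ (∀ x ∈ E, ξ x = 0) ∧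
      ∀ i, ‖permRep Γ X (s i) ξ - ξ‖ < ε) :
    (Fintype.card ι : ℝ) ≤ ‖∑ i, permRep Γ Γ (s i)‖ := by
  by_contra! hlt
  obtain ⟨Φ, hΦ⟩ := hΓ
  let l : Γ → reducedGroupCStar Γ := fun g => ⟨permRep Γ Γ g, permRep_mem_reducedGroupCStar g⟩
  have : CompleteSpace (reducedGroupCStar Γ) :=
    (StarSubalgebra.isClosed_topologicalClosure _).completeSpace_coe
  have : Nontrivial (EllTwo Γ) := by
    classical
    refine ⟨lp.single 2 1 1, 0, fun h => ?_⟩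
    have := congrArg norm h
    simp [lp.norm_single] at this
  have : NormOneClass (reducedGroupCStar Γ) := ⟨norm_one (α := BoundedOps Γ)⟩
  have hl : ((∑ i, l (s i) : reducedGroupCStar Γ) : BoundedOps Γ) = ∑ i, permRep Γ Γ (s i) := by
    simp [l]
  -- If the norm were less than `n = card ι`, then `n - ∑ i, λ_{s i}` would be invertible in
  -- `C*_λ(Γ)`, so `D = n - ∑ i, u_{s i}` would be invertible modulo the compact operators.
  have hres : (Fintype.card ι : ℂ) ∈ resolventSet ℂ (∑ i, l (s i)) := by
    refine spectrum.mem_resolventSet_of_norm_lt ?_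
    rw [Complex.norm_natCast]
    change ‖((∑ i, l (s i) : reducedGroupCStar Γ) : BoundedOps Γ)‖ < _
    rwa [hl]
  have hunit := (spectrum.mem_resolventSet_iff.1 hres).map Φ
  let D : BoundedOps X := ∑ i, (1 - permRep Γ X (s i))
  have hD : Φ (algebraMap ℂ _ (Fintype.card ι : ℂ) - ∑ i, l (s i)) =
      Ideal.Quotient.mk (compactIdeal (EllTwo X)) D := by
    have hl' : ∀ g, Φ (l g) = Ideal.Quotient.mk (compactIdeal (EllTwo X)) (permRep Γ X g) := hΦ
    simp [D, hl', map_sub, map_sum]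
  rw [hD] at hunit
  obtain ⟨t, ht⟩ := hunit.exists_left_inv
  obtain ⟨T, rfl⟩ := Ideal.Quotient.mk_surjective t
  rw [← map_mul, ← map_one (Ideal.Quotient.mk (compactIdeal (EllTwo X))), Ideal.Quotient.eq] at ht
  -- For a left inverse `T` of `D` modulo compacts and `ξ` almost invariant, `T D ξ` is small, while
  -- `(T D - 1) ξ` is small for `ξ` supported off a large finite set.
  obtain ⟨ε, hε, hε'⟩ : ∃ ε : ℝ, 0 < ε ∧ ‖T‖ * (Fintype.card ι * ε) < 1 / 2 := by
    refine ⟨1 / (2 * (‖T‖ * Fintype.card ι + 1)), by positivity, ?_⟩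
    have : 0 ≤ ‖T‖ * Fintype.card ι := by positivity
    rw [← mul_assoc, mul_one_div, div_lt_div_iff₀ (by positivity) (by positivity)]
    linarith
  choose ξ hξ1 hξ0 hξ using fun E => hs E ε hε
  obtain ⟨E, hE⟩ := exists_norm_compact_lt ht (fun E => (hξ1 E).le) hξ0 (half_pos one_pos)
  have h1 : ‖D (ξ E)‖ ≤ Fintype.card ι * ε := by
    have : D (ξ E) = ∑ i, (ξ E - permRep Γ X (s i) (ξ E)) := by simp [D]
    rw [this]
    refine (norm_sum_le_of_le (n := fun _ => ε) _ fun i _ => ?_).trans (by simp)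
    rw [norm_sub_rev]
    exact (hξ E i).le
  have h2 : ‖T (D (ξ E))‖ < 1 / 2 :=
    ((T.le_opNorm _).trans (mul_le_mul_of_nonneg_left h1 (norm_nonneg _))).trans_lt hε'
  have h3 : (T * D - 1) (ξ E) = T (D (ξ E)) - ξ E := rfl
  rw [h3] at hE
  have h4 := norm_sub_norm_le (ξ E) (ξ E - T (D (ξ E)))
  rw [norm_sub_rev (ξ E) (T (D (ξ E))), sub_sub_cancel, hξ1] at h4
  linarith

theorem norm_sum_le_norm_add_add_card_sub_two {V ι : Type*} [SeminormedAddCommGroup V]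
    [Fintype ι] (v : ι → V) (hv : ∀ i, ‖v i‖ ≤ 1) {i j : ι} (hij : i ≠ j) :
    ‖∑ k, v k‖ ≤ ‖v i + v j‖ + (Fintype.card ι - 2) := by
  classical
  have hj : j ∈ Finset.univ.erase i := by simp [hij.symm]
  have hc : (((Finset.univ.erase i).erase j).card : ℝ) = Fintype.card ι - 2 := by
    have h1 := Finset.card_erase_add_one hj
    have h2 := Finset.card_erase_add_one (Finset.mem_univ i)
    rw [← h1, Finset.card_univ] at h2
    rw [← h2]; push_cast; ring
  rw [← Finset.add_sum_erase _ _ (Finset.mem_univ i), ← Finset.add_sum_erase _ _ hj, ← add_assoc]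
  refine (norm_add_le _ _).trans (add_le_add_right ?_ _)
  rw [← hc]
  simpa using norm_sum_le_of_le ((Finset.univ.erase i).erase j) fun k _ => hv k

/-- If `1 ∈ F` and `∑ g ∈ F, u_g` has norm `|F|`, then there are unit vectors that are almost
invariant under `F`: where the norm is nearly attained, `‖u_g η + η‖` is close to `2`, so that
`‖u_g η - η‖` is small by the parallelogram law. -/
theorem exists_almost_invariant_of_card_le {Γ Y : Type*} [Group Γ] [MulAction Γ Y] (F : Finset Γ)
    (h1 : 1 ∈ F) (hF : (F.card : ℝ) ≤ ‖∑ g : F, permRep Γ Y g‖) {ε : ℝ} (hε : 0 < ε) :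
    ∃ η : EllTwo Y, ‖η‖ = 1 ∧ ∀ g ∈ F, ‖permRep Γ Y g η - η‖ < ε := by
  obtain ⟨δ, hδ, hδ1, hδε⟩ : ∃ δ : ℝ, 0 < δ ∧ δ < 1 ∧ 4 * δ < ε ^ 2 :=
    ⟨min (1 / 2) (ε ^ 2 / 5), by positivity, by linarith [min_le_left (1 / 2) (ε ^ 2 / 5)],
      by nlinarith [min_le_right (1 / 2) (ε ^ 2 / 5)]⟩
  have hcard : (1 : ℝ) ≤ F.card := by exact_mod_cast Finset.card_pos.2 ⟨1, h1⟩
  obtain ⟨η, hη, hηF⟩ : ∃ η : EllTwo Y, ‖η‖ = 1 ∧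
      F.card - δ < ‖(∑ g : F, permRep Γ Y g) η‖ := by
    by_contra! h
    have := ContinuousLinearMap.opNorm_le_of_unit_norm (f := ∑ g : F, permRep Γ Y g)
      (by linarith) h
    linarith
  refine ⟨η, hη, fun g hg => ?_⟩
  rcases eq_or_ne g 1 with rfl | hg1
  · simpa using hε
  have h2 := norm_sum_le_norm_add_add_card_sub_two
    (fun g : F => permRep Γ Y g η)
    (fun g => (norm_permRep _ _).le.trans hη.le) (i := ⟨g, hg⟩) (j := ⟨1, h1⟩) (by simpa using hg1)
  rw [_root_.sum_apply] at hηF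
  simp only [map_one, one_apply_eq_self, Fintype.card_coe] at h2
  have h3 := parallelogram_law_with_norm ℂ (permRep Γ Y g η) η
  rw [norm_permRep, hη] at h3
  refine lt_of_pow_lt_pow_left₀ 2 hε.le ?_
  nlinarith

/-! ### Amenability from almost invariant vectors -/

/-- The mass `∑_{y ∈ A} |η(y)|²` that `η ∈ ℓ²(Y)` gives to the set `A`. -/
noncomputable def massOn {Y : Type*} (η : EllTwo Y) (A : Set Y) : ℝ :=
  ∑' y, A.indicator (fun y => ‖η y‖ ^ 2) y

section Mass

variable {Y : Type*} (η ζ : EllTwo Y) (A : Set Y)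

theorem massOn_nonneg : 0 ≤ massOn η A :=
  tsum_nonneg fun _ => Set.indicator_nonneg (fun _ _ => by positivity) _

theorem massOn_univ : massOn η Set.univ = ‖η‖ ^ 2 := by
  simpa [massOn] using (ellTwo_hasSum_norm_sq η).tsum_eq

theorem massOn_union {A B : Set Y} (h : Disjoint A B) :
    massOn η (A ∪ B) = massOn η A + massOn η B := by
  have hs := (ellTwo_hasSum_norm_sq η).summable
  rw [massOn, massOn, massOn, Set.indicator_union_of_disjoint h]
  exact (hs.indicator A).tsum_add (hs.indicator B)

theorem massOn_le : massOn η A ≤ ‖η‖ ^ 2 := by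
  rw [← massOn_univ, ← Set.union_compl_self A, massOn_union η disjoint_compl_right]
  linarith [massOn_nonneg η Aᶜ]

/-- The mass is the squared norm of the restriction to `A`, and restriction is contractive. -/
theorem abs_massOn_sub_le :
    |massOn η A - massOn ζ A| ≤ ‖η - ζ‖ * (‖η‖ + ‖ζ‖) := by
  let P : EllTwo Y → EllTwo Y := fun ξ => ⟨A.indicator ξ, memℓp_gen (by
    refine ((ellTwo_hasSum_norm_sq ξ).summable.indicator A).congr fun y => ?_
    by_cases hy : y ∈ A <;> simp [hy])⟩
  have hP : ∀ ξ, ‖P ξ‖ ^ 2 = massOn ξ A := fun ξ => by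
    rw [← (ellTwo_hasSum_norm_sq (P ξ)).tsum_eq]
    refine tsum_congr fun y => ?_
    change ‖A.indicator ξ y‖ ^ 2 = _
    by_cases hy : y ∈ A <;> simp [hy]
  have hP1 : ∀ ξ, ‖P ξ‖ ≤ ‖ξ‖ := fun ξ =>
    (sq_le_sq₀ (norm_nonneg _) (norm_nonneg _)).1 ((hP ξ).trans_le (massOn_le ξ A))
  have hsub : P η - P ζ = P (η - ζ) := by
    ext y
    exact (congrFun (Set.indicator_sub A η ζ) y).symm
  rw [← hP, ← hP, sq_sub_sq, abs_mul, mul_comm, abs_of_nonneg (by positivity : 0 ≤ ‖P η‖ + ‖P ζ‖)]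
  gcongr
  · exact (abs_norm_sub_norm_le _ _).trans (hsub ▸ hP1 _)
  · exact hP1 η
  · exact hP1 ζ

theorem massOn_permRep {Γ : Type*} [Group Γ] [MulAction Γ Y] (g : Γ) :
    massOn (permRep Γ Y g η) ((g⁻¹ • ·) ⁻¹' A) = massOn η A :=
  (MulAction.toPerm g⁻¹).tsum_eq (A.indicator fun y => ‖η y‖ ^ 2)

end Mass

/-- Almost invariant unit vectors of `ℓ²(Y)` make `Λ` amenable when `Y` maps equivariantly to `Λ`:
push the probability vectors `|η|²` forward to `Λ` and pass to an ultralimit. -/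
theorem isAmenable_of_almost_invariant {Λ Y : Type*} [Group Λ] [MulAction Λ Y] (r : Y → Λ)
    (hr : ∀ (g : Λ) y, r (g • y) = g * r y)
    (h : ∀ (F : Finset Λ) (ε : ℝ), 0 < ε → ∃ η : EllTwo Y, ‖η‖ = 1 ∧
      ∀ g ∈ F, ‖permRep Λ Y g η - η‖ < ε) : IsAmenable Λ := by
  classical
  choose! η hη hinv using h
  let U : Ultrafilter (Finset Λ × ℕ) := Ultrafilter.of atTop
  let w : Finset Λ × ℕ → EllTwo Y := fun q => η q.1 (1 / (q.2 + 1))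
  have hw1 : ∀ q, ‖w q‖ = 1 := fun q => hη _ _ (by positivity)
  have hmem : ∀ A q, massOn (w q) (r ⁻¹' A) ∈ Set.Icc (0 : ℝ) 1 := fun A q =>
    ⟨massOn_nonneg _ _, by simpa [hw1] using massOn_le (w q) (r ⁻¹' A)⟩
  have hlim : ∀ A : Set Λ, ∃ a ∈ Set.Icc (0 : ℝ) 1,
      Tendsto (fun q => massOn (w q) (r ⁻¹' A)) U (𝓝 a) := fun A =>
    isCompact_Icc.ultrafilter_le_nhds (U.map fun q => massOn (w q) (r ⁻¹' A))
      (le_principal_iff.2 (Ultrafilter.mem_map.2 (Eventually.of_forall (hmem A))))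
  choose m hm hmlim using hlim
  refine ⟨m, fun A => (hm A).1, ?_, fun A B hAB => ?_, fun g A => ?_⟩
  · refine tendsto_nhds_unique (hmlim _) ?_
    simp [massOn_univ, hw1]
  · refine tendsto_nhds_unique (hmlim _) ?_
    simp only [Set.preimage_union, massOn_union _ (hAB.preimage r)]
    exact (hmlim A).add (hmlim B)
  · have hset : r ⁻¹' ((g * ·) '' A) = (g⁻¹ • ·) ⁻¹' (r ⁻¹' A) := by
      ext y
      simp [hr]
    have hbound : ∀ᶠ q in (U : Filter (Finset Λ × ℕ)),
        ‖massOn (w q) (r ⁻¹' ((g * ·) '' A)) - massOn (w q) (r ⁻¹' A)‖ ≤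
          1 / ((q.2 : ℝ) + 1) * 2 := by
      refine Ultrafilter.of_le _ ((eventually_ge_atTop ({g}, 0)).mono fun q hq => ?_)
      have h1 := abs_massOn_sub_le (w q) (permRep Λ Y g (w q)) (r ⁻¹' ((g * ·) '' A))
      have h2 := hinv q.1 (1 / ((q.2 : ℝ) + 1)) (by positivity) g (hq.1 (by simp))
      have h3 : ‖permRep Λ Y g (w q)‖ = 1 := ((permIsometry g).norm_map _).trans (hw1 q)
      rw [hset, massOn_permRep, hw1, h3, norm_sub_rev] at h1
      rw [hset, Real.norm_eq_abs]
      refine h1.trans ?_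
      rw [one_add_one_eq_two]
      gcongr
    have hzero : Tendsto (fun q : Finset Λ × ℕ => 1 / ((q.2 : ℝ) + 1) * 2) U (𝓝 0) := by
      have : Tendsto (fun q : Finset Λ × ℕ => q.2) U atTop :=
        (tendsto_snd.mono_left (prod_atTop_atTop_eq (α := Finset Λ) (β := ℕ)).ge).mono_left
          (Ultrafilter.of_le _)
      simpa using ((tendsto_one_div_add_atTop_nhds_zero_nat (𝕜 := ℝ)).comp this).mul_const 2
    exact sub_eq_zero.1 (tendsto_nhds_unique ((hmlim _).sub (hmlim A))
      (squeeze_zero_norm' hbound hzero))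

/-- `Γ` maps `Λ`-equivariantly to `Λ`: divide by a representative of the right coset. -/
theorem Subgroup.exists_equivariant_map {Γ : Type*} [Group Γ] (Λ : Subgroup Γ) :
    ∃ r : Γ → Λ, ∀ (g : Λ) y, r (g • y) = g * r y := by
  let c : Γ → Γ := fun y => (Quotient.mk (QuotientGroup.rightRel Λ) y).out
  have hc : ∀ y, y * (c y)⁻¹ ∈ Λ := fun y =>
    QuotientGroup.rightRel_apply.1 (Quotient.mk_out (s := QuotientGroup.rightRel Λ) y)
  refine ⟨fun y => ⟨y * (c y)⁻¹, hc y⟩, fun g y => Subtype.ext ?_⟩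
  have : c (g • y) = c y := congrArg Quotient.out (Quotient.sound
    (QuotientGroup.rightRel_apply.2 (by simp [Subgroup.smul_def])))
  simp only [this]
  exact mul_assoc _ _ _

/-! ### Amenability of stabilizers of boundary measures -/

/-- Let a countable discrete group `Γ` act on a countable set `X` so that the Calkin representation
is tempered. Every subgroup `Λ` of `Γ` that fixes a probability measure on `∂_β X` is amenable. -/
theorem theorem1 {Γ : Type*} [Group Γ] [Countable Γ] {X : Type*} [Countable X] [MulAction Γ X]
    (hΓ : IsTempered (calkinRep Γ X)) (Λ : Subgroup Γ)
    (hΛ : ∃ μ : MeasureTheory.Measure (StoneCechBoundary X),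
      MeasureTheory.IsProbabilityMeasure μ ∧ ∀ g ∈ Λ, μ.map (g • ·) = μ) :
    IsAmenable Λ := by
  obtain ⟨μ, hμ, hinv⟩ := hΛ
  obtain ⟨r, hr⟩ := Λ.exists_equivariant_map
  refine isAmenable_of_almost_invariant r hr fun F ε hε => ?_
  classical
  obtain ⟨η, hη, hηF⟩ := exists_almost_invariant_of_card_le (Y := Γ) (insert 1 F)
    (Finset.mem_insert_self _ _) (by
      let s : (insert 1 F : Finset Λ) → Γ := fun g => g.1
      have := card_le_norm_sum_regular hΓ s fun E ε hε =>
        exists_almost_invariant_vector s μ (fun g => hinv g.1 g.1.2) E hε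
      rwa [Fintype.card_coe] at this) hε
  exact ⟨η, hη, fun g hg => hηF g (Finset.mem_insert_of_mem hg)⟩
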